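/- Let $G$ be a finite simple graph that is not bipartite and that is embedded in the projective plane so that every face is an open disk bounded by a cycle of $G$ of even length (an even-face embedding). Let $G^*$ be the dual graph: its nodes are the faces, and every edge $e$ of $G$ gives a dual edge joining the two faces that have $e$ on their boundary. Let $D$ be an alternating orientation of $G^*$, that is, an orientation such that in the local cyclic ordering of the dual edges at each dual node $f$ (the order in which the corresponding edges of $G$ follow each other on the cycle bounding $f$) the arcs alternately leave and enter $f$. Identify $\mathbb{R}^{E(G)}$ with the vectors indexed by the arcs of $D$ through the bijection between edges of $G$ and dual edges. Let $M\in\{0,1\}^{E(G)\times V(G)}$ be the edge-node incidence matrix of $G$, and let $$P(G):=\operatorname{conv}\{x\in\mathbb{Z}^{V(G)} \mid Mx\le \mathbf{1}\},\qquad \sigma(x):=\mathbf{1}-Mx,\qquad Q(G):=\sigma(P(G))\subseteq\mathbb{R}^{E(G)}.$$ Then, for every odd cycle $C$ of $G$, $$Q(G)=\operatorname{conv}\{y\in\mathbb{Z}^{E(G)}_{\ge 0} \mid y \text{ is a circulation in } D \text{ and } y(E(C)) \text{ is odd}\},$$ where $y$ is a circulation in $D$ if at every node of $D$ the total of $y$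 over the entering arcs equals the total over the leaving arcs, and $y(E(C)):=\sum_{e\in E(C)}y_e$. -/

import Mathlib

noncomputable section

namespace OddCirc

/-- Antipodal equivalence on the unit sphere of Euclidean 3-space. -/
def antipodal : Setoid (Metric.sphere (0 : EuclideanSpace ℝ (Fin 3)) 1) where
  r p q := p = q ∨ p = -q
  iseqv := by
    refine ⟨fun p => Or.inl rfl, ?_, ?_⟩
    · rintro p q (h | h)
      · exact Or.inl h.symm
      · exact Or.inr (by rw [h, neg_neg])
    · rintro p q r (h | h) (h' | h')
      · exact Or.inl (h.trans h')
      · exact Or.inr (h.trans h')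
      · exact Or.inr (by rw [h, h'])
      · exact Or.inl (by rw [h, h', neg_neg])

/-- The projective plane: the 2-sphere with antipodal points identified (quotient topology). -/
abbrev ProjectivePlane : Type := Quotient antipodal

variable {V : Type*} {G : SimpleGraph V}

/-- An embedding (drawing without crossings) of the graph `G` in the projective plane: distinct
vertices are distinct points, every edge is a simple arc joining its two ends, and the interior of
an arc contains no vertex and meets no other arc. -/
structure Embedding (G : SimpleGraph V) where
  /-- the point representing a vertex -/
  vtx : V → ProjectivePlane
  /-- the arc representing an edge -/
  arc : G.edgeSet → unitInterval → ProjectivePlane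
  vtx_injective : Function.Injective vtx
  arc_continuous : ∀ e, Continuous (arc e)
  arc_injective : ∀ e, Function.Injective (arc e)
  arc_ends : ∀ e : G.edgeSet, s(arc e 0, arc e 1) = Sym2.map vtx (e : Sym2 V)
  arc_avoids_vtx : ∀ (e : G.edgeSet) (t : unitInterval), t ≠ 0 → t ≠ 1 → ∀ v, arc e t ≠ vtx v
  arc_disjoint : ∀ (e e' : G.edgeSet) (s t : unitInterval), s ≠ 0 → s ≠ 1 → t ≠ 0 → t ≠ 1 →
    arc e s = arc e' t → e = e'

namespace Embedding

variable (ε : Embedding G)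

/-- The set of points of the drawing of `G`. -/
def carrier : Set ProjectivePlane := Set.range ε.vtx ∪ ⋃ e, Set.range (ε.arc e)

/-- The faces: the connected components of the complement of the drawing. -/
def Face : Type := {F : Set ProjectivePlane // ∃ p ∈ ε.carrierᶜ, 
  F = connectedComponentIn ε.carrierᶜ p}

/-- The set of points of the drawing of a closed walk of positive length. -/
def trace {v : V} (C : G.Walk v v) : Set ProjectivePlane :=
  ⋃ (e : G.edgeSet) (_ : (e : Sym2 V) ∈ C.edges), Set.range (ε.arc e)

/-- The set `F` is an open disk bounded by the cycle `C`: there is a homeomorphism of the closed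
unit disk into the projective plane (continuous and injective on a compact set) that maps the open
disk onto `F` and the boundary circle onto the drawing of `C`. -/
def IsDiskBoundedBy (F : Set ProjectivePlane) {v : V} (C : G.Walk v v) : Prop :=
  ∃ φ : EuclideanSpace ℝ (Fin 2) → ProjectivePlane,
    ContinuousOn φ (Metric.closedBall 0 1) ∧ Set.InjOn φ (Metric.closedBall 0 1) ∧
    φ '' Metric.ball 0 1 = F ∧ φ '' Metric.sphere 0 1 = ε.trace C

/-- Even-face embedding: every face is an open disk bounded by an even cycle of `G`. -/
def IsEvenFace : Prop :=
  ∀ F : ε.Face, ∃ (v : V) (C : G.Walk v v), C.IsCycle ∧ Even C.length ∧ ε.IsDiskBoundedBy F.1 C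

/-- The edge `e` lies on the boundary of the face `F`, i.e. the dual edge of `e` is incident to the
dual node `F`. -/
def OnBoundary (e : G.edgeSet) (F : ε.Face) : Prop := Set.range (ε.arc e) ⊆ closure F.1

/-- An orientation of the dual graph. The dual nodes are the faces; the dual edge of `e` joins
the two faces that have `e` on their boundary (two different ones, since every face is bounded by a
cycle). It is oriented from `tail e` to `head e`. -/
structure DualOrientation where
  /-- the face that the dual arc of an edge leaves -/
  tail : G.edgeSet → ε.Face
  /-- the face that the dual arc of an edge enters -/
  head : G.edgeSet → ε.Face
  tail_ne_head : ∀ e, tail e ≠ head e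
  onBoundary_iff : ∀ e F, ε.OnBoundary e F ↔ F = tail e ∨ F = head e

namespace DualOrientation

variable {ε}
variable (D : ε.DualOrientation)

/-- The orientation is alternating. The cyclic order of the dual edges around the dual node `F` is
the cyclic order of the corresponding edges on the boundary cycle of `F`, and two edges of a cycle
are consecutive on it when they are different and share an end. Of two such edges one is crossed
by an arc that enters `F` and the other one by an arc that leaves `F`. -/
def IsAlternating : Prop :=
  ∀ (F : ε.Face) (e e' : G.edgeSet), ε.OnBoundary e F → ε.OnBoundary e' F → e ≠ e' →
    (∃ v, v ∈ (e : Sym2 V) ∧ v ∈ (e' : Sym2 V)) → (D.head e = F ↔ D.tail e' = F)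

open Classical in
/-- `y` is a circulation in `D`: at every dual node inflow equals outflow. -/
def IsCirculation [Fintype G.edgeSet] (y : G.edgeSet → ℝ) : Prop :=
  ∀ F : ε.Face, ∑ e : G.edgeSet with D.head e = F, y e = ∑ e : G.edgeSet with D.tail e = F, y e

end DualOrientation

end Embedding

open Classical in
/-- The edge-node incidence matrix of `G`. -/
def incidence (G : SimpleGraph V) : Matrix G.edgeSet V ℝ :=
  Matrix.of fun e v => if v ∈ (e : Sym2 V) then 1 else 0

/-- The polyhedron `P(G)`: the convex hull of the integer points `x` with `M x ≤ 1`. -/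
def P [Fintype V] (G : SimpleGraph V) : Set (V → ℝ) :=
  convexHull ℝ {x | (∃ z : V → ℤ, ∀ v, x v = z v) ∧ (incidence G).mulVec x ≤ 1}

/-- The affine map `σ x = 1 - M x`. -/
def sigma [Fintype V] (G : SimpleGraph V) (x : V → ℝ) : G.edgeSet → ℝ :=
  1 - (incidence G).mulVec x

/-- The image `Q(G)` of `P(G)` under `σ`. -/
def Q [Fintype V] (G : SimpleGraph V) : Set (G.edgeSet → ℝ) := sigma G '' P G

end OddCirc

end

noncomputable section

open Set Filter Topology

/-! Since `σ` is affine, it suffices to match the integer points (`image_sigma_eq`). On an even face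
cycle alternation turns "inflow equals outflow" into "the alternating sum of `y` vanishes". The
all-ones vector satisfies this, and edge sums `x u + x v` telescope to zero, so `σ x` is a
circulation; its sum over an odd cycle is an odd length minus an even number.

The converse asks for integers `x` with edge sums `w = 1 - y`. Over a single closed cell (vertex,
edge or face) such labellings exist and are determined by one value, precisely because alternating
sums around faces vanish. They therefore form a locally constant sheaf with fibre `ℤ`
(`LabelSystem`) on the projective plane, possibly with monodromy. Pulled back to the sphere it has a
global section `s` (`exists_isSection_sphere`). The sum `s p + s (-p)` descends to the projective
plane and gives a labelling `z` of the vertices with edge sums `2 w` (`exists_double_labelling`).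
All values of `z` have the same parity. The sum of `z` over the odd cycle equals that of `w`, which
is even, so all values are even, and `z / 2` is the required `x` (`exists_labelling_of_even_sum`).
-/

namespace OddCirc

/-! ### Locally constant systems of integer labellings and their sections over the sphere. -/

section

/-- A family of sets of integer labellings over the points of a space `B`, behaving like the sections
of a locally constant sheaf with fiber `ℤ`. -/
structure LabelSystem (B V : Type*) [TopologicalSpace B] where
  /-- the vertices on which a labelling over the given point matters -/
  verts : B → Set V
  /-- the admissible labellings over a point -/
  sol : B → Set (V → ℤ)
  nonempty : ∀ b, (verts b).Nonempty
  exists_sol : ∀ b, ∀ v ∈ verts b, ∀ k, ∃ X ∈ sol b, X v = k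
  eqOn_of_eq : ∀ b, ∀ X ∈ sol b, ∀ Y ∈ sol b, ∀ v ∈ verts b, X v = Y v → EqOn X Y (verts b)
  -- Passing to a nearby point may enlarge the cell: more vertices matter and more equations hold. A
  -- labelling over `c` thus restricts to one over `b`.
  eventually_le : ∀ b, ∀ᶠ c in 𝓝 b, verts b ⊆ verts c ∧ sol c ⊆ sol b

namespace LabelSystem

variable {B A V : Type*} [TopologicalSpace B] [TopologicalSpace A]

/-- A global section of a label system. -/
structure IsSection (S : LabelSystem B V) (s : B → V → ℤ) : Prop where
  mem_sol : ∀ b, s b ∈ S.sol b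
  eventually_eqOn : ∀ b, ∀ᶠ c in 𝓝 b, EqOn (s c) (s b) (S.verts b)

/-- The pullback of a label system along a continuous map. -/
def comap (S : LabelSystem B V) (f : A → B) (hf : Continuous f) : LabelSystem A V where
  verts a := S.verts (f a)
  sol a := S.sol (f a)
  nonempty a := S.nonempty (f a)
  exists_sol a := S.exists_sol (f a)
  eqOn_of_eq a := S.eqOn_of_eq (f a)
  eventually_le a := hf.continuousAt.eventually (S.eventually_le (f a))

variable (S : LabelSystem B V)

/-- The set of points over which `v` is a relevant vertex. -/
def star (v : V) : Set B := {b | v ∈ S.verts b}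

theorem isOpen_star (v : V) : IsOpen (S.star v) :=
  isOpen_iff_mem_nhds.2 fun b hb => (S.eventually_le b).mono fun _ hc => hc.1 hb

open Classical in
/-- The value at `j` of the labelling over `b` with value `k` at `i`. -/
def transport (i j : V) (b : B) (k : ℤ) : ℤ :=
  if h : ∃ X ∈ S.sol b, X i = k then h.choose j else 0

theorem transport_apply {i j : V} {b : B} (hi : i ∈ S.verts b) (hj : j ∈ S.verts b)
    {X : V → ℤ} (hX : X ∈ S.sol b) : S.transport i j b (X i) = X j := by
  have h : ∃ Y ∈ S.sol b, Y i = X i := ⟨X, hX, rfl⟩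
  rw [transport, dif_pos h]
  exact S.eqOn_of_eq b _ h.choose_spec.1 _ hX i hi h.choose_spec.2 hj

/-- The bundle of labellings, trivialized over the stars of the vertices. -/
def bundleCore : FiberBundleCore V B ℤ where
  baseSet := S.star
  isOpen_baseSet := S.isOpen_star
  indexAt b := (S.nonempty b).some
  mem_baseSet_at b := (S.nonempty b).some_mem
  coordChange := S.transport
  coordChange_self i b hb k := by
    obtain ⟨X, hX, rfl⟩ := S.exists_sol b i hb k
    exact S.transport_apply hb hb hX
  continuousOn_coordChange i j := by
    rintro ⟨b, k⟩ ⟨⟨hi, hj⟩, -⟩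
    refine ContinuousAt.continuousWithinAt ?_
    -- The fibre is discrete, so continuity means local constancy: a labelling over a nearby point
    -- is also one over `b`, hence gives the same transport.
    have : ∀ᶠ p : B × ℤ in 𝓝 (b, k), S.transport i j p.1 p.2 = S.transport i j b k := by
      have h1 : ∀ᶠ p : B × ℤ in 𝓝 (b, k), S.verts b ⊆ S.verts p.1 ∧ S.sol p.1 ⊆ S.sol b :=
        (continuous_fst (X := B) (Y := ℤ)).continuousAt (x := (b, k)) |>.eventually (S.eventually_le b)
      have h2 : ∀ᶠ p : B × ℤ in 𝓝 (b, k), p.2 = k :=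
        (continuous_snd (X := B) (Y := ℤ)).continuousAt (x := (b, k)) |>.eventually
          ((isOpen_discrete {k}).mem_nhds rfl)
      filter_upwards [h1, h2] with p hp hk
      obtain ⟨X, hX, hXk⟩ := S.exists_sol p.1 i (hp.1 hi) k
      rw [hk, ← hXk, S.transport_apply (hp.1 hi) (hp.1 hj) hX,
        S.transport_apply hi hj (hp.2 hX)]
    exact (continuousAt_const (y := S.transport i j b k)).congr (this.mono fun p hp => hp.symm)
  coordChange_comp i j k b hb n := by
    obtain ⟨X, hX, rfl⟩ := S.exists_sol b i hb.1.1 n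
    rw [S.transport_apply hb.1.1 hb.1.2 hX, S.transport_apply hb.1.2 hb.2 hX,
      S.transport_apply hb.1.1 hb.2 hX]

/-- A bundle with discrete fibre is a covering, so over a simply connected, locally path connected
base the identity map lifts through any prescribed point; the lift is a section. -/
theorem exists_isSection_of_simplyConnected [SimplyConnectedSpace B] [LocallyPathConnectedSpace B]
    {b₀ : B} {X₀ : V → ℤ} (hX₀ : X₀ ∈ S.sol b₀) :
    ∃ s, S.IsSection s ∧ EqOn (s b₀) X₀ (S.verts b₀) := by
  have hcov : IsCoveringMap S.bundleCore.proj := FiberBundle.isCoveringMap (F := ℤ)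
  obtain ⟨F, ⟨hF₀, hF⟩, -⟩ := hcov.existsUnique_continuousMap_lifts (ContinuousMap.id B) b₀
    (⟨b₀, X₀ (S.bundleCore.indexAt b₀)⟩ : S.bundleCore.TotalSpace) rfl
  have hproj : ∀ b, (F b).1 = b := fun b => congrFun hF b
  have hidx : ∀ b, S.bundleCore.indexAt b ∈ S.verts b := S.bundleCore.mem_baseSet_at
  have hval : ∀ b, ∃ X ∈ S.sol b, X (S.bundleCore.indexAt b) = (F b).2 := fun b =>
    S.exists_sol b _ (hidx b) _
  choose s hs hsv using hval
  have key : ∀ v b, v ∈ S.verts b → (S.bundleCore.localTriv v (F b)).2 = s b v := by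
    intro v b hv
    have : (S.bundleCore.localTriv v (F b)).2 =
        S.transport (S.bundleCore.indexAt (F b).1) v (F b).1 (F b).2 := rfl
    rw [this, hproj b, ← hsv b, S.transport_apply (hidx b) hv (hs b)]
  refine ⟨s, ⟨hs, fun b => ?_⟩, ?_⟩
  · obtain ⟨v, hv⟩ := S.nonempty b
    -- The default chart index may jump with the base point. Reading the lift in one fixed chart `v`
    -- gives a continuous integer-valued, hence locally constant, function.
    have hc : ContinuousAt (fun c => (S.bundleCore.localTriv v (F c)).2) b := by
      refine continuous_snd.continuousAt.comp (ContinuousAt.comp (x := b)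
        (g := S.bundleCore.localTriv v) ?_ F.continuous.continuousAt)
      refine (S.bundleCore.localTriv v).continuousAt ?_
      rw [FiberBundleCore.mem_localTriv_source]
      change (F b).1 ∈ S.star v
      rw [hproj b]
      exact hv
    have h1 := hc.eventually ((isOpen_discrete {_}).mem_nhds rfl)
    filter_upwards [h1, S.eventually_le b] with c hc1 hc2
    rw [key v c (hc2.1 hv), key v b hv] at hc1
    exact S.eqOn_of_eq b _ (hc2.2 (hs c)) _ (hs b) v hv hc1
  · refine S.eqOn_of_eq b₀ _ (hs b₀) _ hX₀ _ (hidx b₀) ?_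
    rw [hsv b₀, hF₀]

variable {S}

/-- Two local sections that agree at a point of a preconnected set agree on the whole set. -/
theorem eqOn_of_isPreconnected {U : Set B} (hU : IsPreconnected U) {s t : B → V → ℤ}
    (hs : ∀ b ∈ U, s b ∈ S.sol b) (ht : ∀ b ∈ U, t b ∈ S.sol b)
    (hs' : ∀ b ∈ U, ∀ᶠ c in 𝓝 b, EqOn (s c) (s b) (S.verts b))
    (ht' : ∀ b ∈ U, ∀ᶠ c in 𝓝 b, EqOn (t c) (t b) (S.verts b))
    {b₀ : B} (hb₀ : b₀ ∈ U) (h₀ : EqOn (s b₀) (t b₀) (S.verts b₀)) {b : B} (hb : b ∈ U) :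
    EqOn (s b) (t b) (S.verts b) := by
  -- Agreement and disagreement both persist locally, so the truth value of "the sections agree" is
  -- constant on a preconnected set.
  refine hU.induction₂ (fun x y => EqOn (s x) (t x) (S.verts x) ↔ EqOn (s y) (t y) (S.verts y))
    ?_ ?_ ?_ hb₀ hb |>.1 h₀
  · intro x hx
    refine eventually_nhdsWithin_iff.2 ?_
    filter_upwards [hs' x hx, ht' x hx, S.eventually_le x] with y h1 h2 h3 hy
    obtain ⟨v, hv⟩ := S.nonempty x
    constructor
    · intro h
      exact S.eqOn_of_eq y _ (hs y hy) _ (ht y hy) v (h3.1 hv) ((h1 hv).trans ((h hv).trans (h2 hv).symm))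
    · intro h u hu
      rw [← h1 hu, ← h2 hu]
      exact h (h3.1 hu)
  · exact fun x y z _ _ _ h1 h2 => h1.trans h2
  · exact fun x y _ _ h => h.symm

/-- On a sphere minus a point, a label system has sections with a prescribed germ. -/
theorem exists_section_compl_singleton
    (S : LabelSystem (Metric.sphere (0 : EuclideanSpace ℝ (Fin 3)) 1) V)
    (v b₀ : Metric.sphere (0 : EuclideanSpace ℝ (Fin 3)) 1) (hb₀ : b₀ ≠ v) {X₀ : V → ℤ}
    (hX₀ : X₀ ∈ S.sol b₀) :
    ∃ s : _ → V → ℤ, (∀ b ≠ v, s b ∈ S.sol b) ∧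
      (∀ b ≠ v, ∀ᶠ c in 𝓝 b, EqOn (s c) (s b) (S.verts b)) ∧ EqOn (s b₀) X₀ (S.verts b₀) := by
  have : Fact (Module.finrank ℝ (EuclideanSpace ℝ (Fin 3)) = 2 + 1) := ⟨by simp⟩
  let φ := stereographic' 2 v
  have hφ : ∀ b ≠ v, b ∈ φ.source := fun b hb => by
    rw [stereographic'_source]; exact hb
  have hinv : ∀ b ≠ v, φ.symm (φ b) = b := fun b hb => φ.left_inv (hφ b hb)
  have hc : Continuous φ.symm := by
    have := φ.continuousOn_symm
    rwa [stereographic'_target, ← continuousOn_univ] at *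
  obtain ⟨t, ht, ht₀⟩ := (S.comap φ.symm hc).exists_isSection_of_simplyConnected
    (b₀ := φ b₀) (X₀ := X₀) (by change X₀ ∈ S.sol (φ.symm (φ b₀)); rwa [hinv b₀ hb₀])
  refine ⟨fun b => t (φ b), fun b hb => ?_, fun b hb => ?_, ?_⟩
  · have := ht.mem_sol (φ b)
    change _ ∈ S.sol (φ.symm (φ b)) at this
    rwa [hinv b hb] at this
  · have := (φ.continuousAt (hφ b hb)).eventually (ht.eventually_eqOn (φ b))
    refine this.mono fun c hcc => ?_
    change EqOn _ _ (S.verts (φ.symm (φ b))) at hcc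
    rwa [hinv b hb] at hcc
  · change EqOn _ _ (S.verts (φ.symm (φ b₀))) at ht₀
    rwa [hinv b₀ hb₀] at ht₀

/-- Stereographic projection from `v` turns this set into a plane minus one point. -/
theorem isPreconnected_sphere_compl_pair (v : Metric.sphere (0 : EuclideanSpace ℝ (Fin 3)) 1) :
    IsPreconnected {b | b ≠ v ∧ b ≠ -v} := by
  have : Fact (Module.finrank ℝ (EuclideanSpace ℝ (Fin 3)) = 2 + 1) := ⟨by simp⟩
  let φ := stereographic' 2 v
  have hc : Continuous φ.symm := by
    have := φ.continuousOn_symm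
    rwa [stereographic'_target, ← continuousOn_univ] at *
  have hsrc : ∀ b, b ∈ φ.source ↔ b ≠ v := fun b => by
    rw [stereographic'_source]; rfl
  have hne : -v ≠ v := Ne.symm (ne_neg_of_mem_unit_sphere ℝ v)
  have himg : {b | b ≠ v ∧ b ≠ -v} = φ.symm '' {φ (-v)}ᶜ := by
    ext b
    constructor
    · rintro ⟨h1, h2⟩
      refine ⟨φ b, fun h => h2 ?_, φ.left_inv ((hsrc b).2 h1)⟩
      exact φ.injOn ((hsrc _).2 h1) ((hsrc _).2 hne) h
    · rintro ⟨x, hx, rfl⟩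
      have hxt : x ∈ φ.target := by rw [stereographic'_target]; trivial
      refine ⟨(hsrc _).1 (φ.map_target hxt), fun h => hx ?_⟩
      rw [mem_singleton_iff, ← h, φ.right_inv hxt]
  rw [himg]
  refine (isConnected_compl_singleton_of_one_lt_rank ?_ _).isPreconnected.image _ hc.continuousOn
  rw [← Module.finrank_eq_rank]
  simp

/-- Every label system over the sphere has a global section. -/
theorem exists_isSection_sphere
    (S : LabelSystem (Metric.sphere (0 : EuclideanSpace ℝ (Fin 3)) 1) V) : ∃ s, S.IsSection s := by
  classical
  let v : Metric.sphere (0 : EuclideanSpace ℝ (Fin 3)) 1 := ⟨EuclideanSpace.single 0 1, by simp⟩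
  let b₀ : Metric.sphere (0 : EuclideanSpace ℝ (Fin 3)) 1 := ⟨EuclideanSpace.single 1 1, by simp⟩
  have hb1 : b₀ ≠ v := fun h => by
    have := congrArg (fun x : Metric.sphere (0 : EuclideanSpace ℝ (Fin 3)) 1 => x.1 0) h
    simp [v, b₀] at this
  have hb2 : b₀ ≠ -v := fun h => by
    have := congrArg (fun x : Metric.sphere (0 : EuclideanSpace ℝ (Fin 3)) 1 => x.1 0) h
    simp [v, b₀] at this
  obtain ⟨X₀, hX₀, -⟩ := S.exists_sol b₀ _ (S.nonempty b₀).some_mem 0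
  obtain ⟨s, hs, hs', hs₀⟩ := S.exists_section_compl_singleton v b₀ hb1 hX₀
  obtain ⟨t, ht, ht', ht₀⟩ := S.exists_section_compl_singleton (-v) b₀ hb2 hX₀
  have hst : ∀ b, b ≠ v → b ≠ -v → EqOn (s b) (t b) (S.verts b) := fun b h1 h2 =>
    eqOn_of_isPreconnected (isPreconnected_sphere_compl_pair v) (fun b hb => hs b hb.1)
      (fun b hb => ht b hb.2) (fun b hb => hs' b hb.1) (fun b hb => ht' b hb.2) ⟨hb1, hb2⟩
      (hs₀.trans ht₀.symm) ⟨h1, h2⟩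
  have hne : v ≠ -v := ne_neg_of_mem_unit_sphere ℝ v
  -- The section `s` lacks only the point `v`, where `t` supplies the value; near `v` both agree off
  -- `v`, so the glued section is still locally constant.
  refine ⟨fun b => if b = v then t b else s b, ⟨fun b => ?_, fun b => ?_⟩⟩
  · by_cases hb : b = v
    · simpa [hb] using ht v hne
    · simpa [hb] using hs b hb
  · by_cases hb : b = v
    · subst hb
      filter_upwards [ht' v hne, S.eventually_le v, isOpen_ne.mem_nhds hne] with c h1 h2 h3
      by_cases hc : c = v
      · subst hc; exact fun _ _ => rfl
      · simp only [hc, if_true, if_false]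
        exact fun u hu => (hst c hc h3 (h2.1 hu)).trans (h1 hu)
    · filter_upwards [hs' b hb, isOpen_ne.mem_nhds hb] with c h1 h3
      have h3' : c ≠ v := h3
      simpa only [hb, h3', if_false] using h1

end LabelSystem

end

/-! ### Topology of the projective plane and closed cells of the drawing. -/

section

theorem exists_ne_zero_ne_one : ∃ t : unitInterval, t ≠ 0 ∧ t ≠ 1 := by
  refine ⟨⟨1 / 2, by norm_num, by norm_num⟩, fun h => ?_, fun h => ?_⟩ <;>
  · have := congrArg Subtype.val h
    norm_num at this

theorem isOpenMap_antipodal_mk : IsOpenMap (Quotient.mk antipodal) := by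
  intro W hW
  change IsOpen (Quotient.mk antipodal ⁻¹' (Quotient.mk antipodal '' W))
  have : Quotient.mk antipodal ⁻¹' (Quotient.mk antipodal '' W) = W ∪ (fun x => -x) ⁻¹' W := by
    ext x
    constructor
    · rintro ⟨y, hy, hxy⟩
      rcases (Quotient.exact hxy : y = x ∨ y = -x) with rfl | rfl
      · exact Or.inl hy
      · exact Or.inr hy
    · rintro (h | h)
      · exact ⟨x, h, rfl⟩
      · exact ⟨-x, h, Quotient.sound (Or.inr rfl)⟩
  rw [this]
  exact hW.union (hW.preimage continuous_neg)

/-- The function `x ↦ ⟪x, a⟫ ^ 2` is antipodally invariant, and by the equality case of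
Cauchy–Schwarz it takes the value `1` on the sphere only at `±a`. -/
instance : T2Space ProjectivePlane := by
  refine ⟨fun p q => ?_⟩
  induction p, q using Quotient.inductionOn₂ with | _ a b
  intro hne
  let g : ProjectivePlane → ℝ := Quotient.lift (fun x => (inner ℝ x.1 a.1) ^ 2) (by
    rintro x y (h | h)
    · rw [h]
    · simp [h])
  have hg : Continuous g := Continuous.quotient_lift (by fun_prop) _
  refine separated_by_continuous hg fun h => hne ?_
  have h1 : (inner ℝ a.1 a.1) ^ 2 = (inner ℝ b.1 a.1) ^ 2 := h
  have ha : ‖a.1‖ = 1 := norm_eq_of_mem_sphere a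
  have hb : ‖b.1‖ = 1 := norm_eq_of_mem_sphere b
  rw [real_inner_self_eq_norm_sq, ha, one_pow, one_pow, eq_comm, sq_eq_one_iff] at h1
  rcases h1 with h1 | h1
  · exact Quotient.sound (Or.inl (Subtype.ext ((inner_eq_one_iff_of_norm_eq_one hb ha).1 h1).symm))
  · refine (Quotient.sound (Or.inr (Subtype.ext ?_) : antipodal.r b a)).symm
    exact (inner_eq_neg_one_iff_of_norm_eq_one hb ha).1 h1

namespace Embedding

variable {V : Type*} {G : SimpleGraph V} (ε : Embedding G)

theorem mem_of_arc_eq_vtx {e : G.edgeSet} {t : unitInterval} {v : V} (h : ε.arc e t = ε.vtx v) :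
    v ∈ (e : Sym2 V) := by
  have hv : ε.vtx v ∈ s(ε.arc e 0, ε.arc e 1) := by
    by_cases h0 : t = 0
    · rw [← h, h0]; exact Sym2.mem_mk_left _ _
    · by_cases h1 : t = 1
      · rw [← h, h1]; exact Sym2.mem_mk_right _ _
      · exact absurd h (ε.arc_avoids_vtx e t h0 h1 v)
  rw [ε.arc_ends, Sym2.mem_map] at hv
  obtain ⟨u, hu, huv⟩ := hv
  rwa [← ε.vtx_injective huv]

theorem exists_arc_eq_vtx {e : G.edgeSet} {v : V} (h : v ∈ (e : Sym2 V)) :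
    ε.arc e 0 = ε.vtx v ∨ ε.arc e 1 = ε.vtx v := by
  have : ε.vtx v ∈ s(ε.arc e 0, ε.arc e 1) := by
    rw [ε.arc_ends, Sym2.mem_map]; exact ⟨v, h, rfl⟩
  rcases Sym2.mem_iff.1 this with h | h
  · exact Or.inl h.symm
  · exact Or.inr h.symm

theorem vtx_mem_range_arc {e : G.edgeSet} {v : V} (h : v ∈ (e : Sym2 V)) :
    ε.vtx v ∈ range (ε.arc e) := by
  rcases ε.exists_arc_eq_vtx h with h | h
  · exact ⟨0, h⟩
  · exact ⟨1, h⟩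

theorem exists_vtx_eq_arc_zero (e : G.edgeSet) : ∃ v ∈ (e : Sym2 V), ε.arc e 0 = ε.vtx v := by
  have : ε.arc e 0 ∈ Sym2.map ε.vtx e := by rw [← ε.arc_ends]; exact Sym2.mem_mk_left _ _
  obtain ⟨u, hu, huv⟩ := Sym2.mem_map.1 this
  exact ⟨u, hu, huv.symm⟩

theorem exists_vtx_eq_arc_one (e : G.edgeSet) : ∃ v ∈ (e : Sym2 V), ε.arc e 1 = ε.vtx v := by
  have : ε.arc e 1 ∈ Sym2.map ε.vtx e := by rw [← ε.arc_ends]; exact Sym2.mem_mk_right _ _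
  obtain ⟨u, hu, huv⟩ := Sym2.mem_map.1 this
  exact ⟨u, hu, huv.symm⟩

theorem eq_of_arc_mem_range {e e' : G.edgeSet} {t : unitInterval} (h0 : t ≠ 0) (h1 : t ≠ 1)
    (h : ε.arc e t ∈ range (ε.arc e')) : e' = e := by
  obtain ⟨t', ht'⟩ := h
  have h0' : t' ≠ 0 := by
    rintro rfl
    obtain ⟨v, -, hv⟩ := ε.exists_vtx_eq_arc_zero e'
    exact ε.arc_avoids_vtx e t h0 h1 v (ht'.symm.trans hv)
  have h1' : t' ≠ 1 := by
    rintro rfl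
    obtain ⟨v, -, hv⟩ := ε.exists_vtx_eq_arc_one e'
    exact ε.arc_avoids_vtx e t h0 h1 v (ht'.symm.trans hv)
  exact ε.arc_disjoint e' e t' t h0' h1' h0 h1 ht'

theorem range_arc_subset_iff {e e' : G.edgeSet} :
    range (ε.arc e) ⊆ range (ε.arc e') ↔ e = e' := by
  refine ⟨fun h => ?_, fun h => h ▸ Subset.rfl⟩
  obtain ⟨t, h0, h1⟩ := exists_ne_zero_ne_one
  exact (ε.eq_of_arc_mem_range h0 h1 (h ⟨t, rfl⟩)).symm

theorem range_arc_subset_carrier (e : G.edgeSet) : range (ε.arc e) ⊆ ε.carrier :=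
  (subset_iUnion (fun e => range (ε.arc e)) e).trans subset_union_right

theorem trace_subset_carrier {v : V} (C : G.Walk v v) : ε.trace C ⊆ ε.carrier :=
  iUnion₂_subset fun e _ => ε.range_arc_subset_carrier e

theorem range_arc_subset_trace_iff {v : V} {C : G.Walk v v} {e : G.edgeSet} :
    range (ε.arc e) ⊆ ε.trace C ↔ (e : Sym2 V) ∈ C.edges := by
  refine ⟨fun h => ?_, fun h => subset_iUnion₂ (s := fun (e : G.edgeSet)
    (_ : (e : Sym2 V) ∈ C.edges) => range (ε.arc e)) e h⟩
  obtain ⟨t, h0, h1⟩ := exists_ne_zero_ne_one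
  obtain ⟨e', he', ht⟩ := mem_iUnion₂.1 (h ⟨t, rfl⟩)
  rwa [← ε.eq_of_arc_mem_range h0 h1 ht]

variable {ε}

namespace Face

theorem subset_compl_carrier (F : ε.Face) : F.1 ⊆ ε.carrierᶜ := by
  obtain ⟨p, -, hF⟩ := F.2
  rw [hF]
  exact connectedComponentIn_subset _ _

theorem eq_of_mem {F F' : ε.Face} {r : ProjectivePlane} (h : r ∈ F.1) (h' : r ∈ F'.1) :
    F = F' := by
  obtain ⟨p, -, hF⟩ := F.2
  obtain ⟨p', -, hF'⟩ := F'.2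
  apply Subtype.ext
  rw [hF] at h ⊢
  rw [hF'] at h' ⊢
  rw [connectedComponentIn_eq h, connectedComponentIn_eq h']

/-- The image of the closed disk is compact, hence closed in a Hausdorff space, and by continuity it
lies in the closure of the image of the open disk. -/
theorem closure_eq {F : ε.Face} {v : V} {C : G.Walk v v} (h : ε.IsDiskBoundedBy F.1 C) :
    closure F.1 = F.1 ∪ ε.trace C := by
  obtain ⟨φ, hc, -, hball, hsph⟩ := h
  have himg : φ '' Metric.closedBall 0 1 = F.1 ∪ ε.trace C := by
    rw [← hball, ← hsph, ← image_union, Metric.ball_union_sphere]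
  apply Subset.antisymm
  · refine closure_minimal subset_union_left ?_
    rw [← himg]
    exact ((isCompact_closedBall 0 1).image_of_continuousOn hc).isClosed
  · rw [← himg, ← hball, ← closure_ball 0 one_ne_zero]
    apply ContinuousOn.image_closure
    rwa [closure_ball 0 one_ne_zero]

theorem mem_closure_iff {F : ε.Face} {v : V} {C : G.Walk v v} (h : ε.IsDiskBoundedBy F.1 C)
    {r : ProjectivePlane} (hr : r ∈ ε.carrier) : r ∈ closure F.1 ↔ r ∈ ε.trace C := by
  rw [closure_eq h]
  exact ⟨fun h => h.resolve_left fun h => F.subset_compl_carrier h hr, Or.inr⟩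

theorem onBoundary_iff_mem_edges {F : ε.Face} {v : V} {C : G.Walk v v}
    (h : ε.IsDiskBoundedBy F.1 C) {e : G.edgeSet} :
    ε.OnBoundary e F ↔ (e : Sym2 V) ∈ C.edges := by
  rw [← ε.range_arc_subset_trace_iff]
  constructor
  · exact fun h' r hr => (mem_closure_iff h (ε.range_arc_subset_carrier e hr)).1 (h' hr)
  · exact fun h' r hr => (mem_closure_iff h (ε.range_arc_subset_carrier e hr)).2 (h' hr)

end Face

variable (ε)

/-- The closed cells of the drawing. -/
def cell : V ⊕ G.edgeSet ⊕ ε.Face → Set ProjectivePlane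
  | .inl v => {ε.vtx v}
  | .inr (.inl e) => range (ε.arc e)
  | .inr (.inr F) => closure F.1

theorem isClosed_cell (k : V ⊕ G.edgeSet ⊕ ε.Face) : IsClosed (ε.cell k) := by
  rcases k with v | e | F
  · exact isClosed_singleton
  · exact (isCompact_range (ε.arc_continuous e)).isClosed
  · exact isClosed_closure

/-- The vertices that lie in every closed cell containing `r`. -/
def cellVerts (r : ProjectivePlane) : Set V := {v | ∀ k, r ∈ ε.cell k → ε.vtx v ∈ ε.cell k}

/-- The edges that lie in every closed cell containing `r`. -/
def cellEdges (r : ProjectivePlane) : Set G.edgeSet :=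
  {e | ∀ k, r ∈ ε.cell k → range (ε.arc e) ⊆ ε.cell k}

/-- Points near `r` avoid each of the finitely many closed cells that miss `r`. Fewer cells to test
means more vertices and edges pass. -/
theorem eventually_cell_subset [Finite V] [Finite G.edgeSet] [Finite ε.Face] (r : ProjectivePlane) :
    ∀ᶠ q in 𝓝 r, ε.cellVerts r ⊆ ε.cellVerts q ∧ ε.cellEdges r ⊆ ε.cellEdges q := by
  have : ∀ᶠ q in 𝓝 r, ∀ k, q ∈ ε.cell k → r ∈ ε.cell k := by
    rw [eventually_all]
    intro k
    by_cases h : r ∈ ε.cell k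
    · exact Eventually.of_forall fun _ _ => h
    · filter_upwards [(ε.isClosed_cell k).isOpen_compl.mem_nhds h] with q hq hq'
      exact absurd hq' hq
  filter_upwards [this] with q hq
  exact ⟨fun v hv k hk => hv k (hq k hk), fun e he k hk => he k (hq k hk)⟩

theorem cellVerts_vtx (v : V) : ε.cellVerts (ε.vtx v) = {v} := by
  apply Subset.antisymm
  · exact fun u hu => ε.vtx_injective (hu (.inl v) rfl)
  · rintro u rfl k hk
    exact hk

theorem cellEdges_vtx (v : V) : ε.cellEdges (ε.vtx v) = ∅ := by
  refine eq_empty_of_forall_notMem fun e he => ?_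
  have h0 : ε.arc e 0 = ε.vtx v := he (.inl v) rfl ⟨0, rfl⟩
  have h1 : ε.arc e 1 = ε.vtx v := he (.inl v) rfl ⟨1, rfl⟩
  exact zero_ne_one (ε.arc_injective e (h0.trans h1.symm))

variable {ε}

/-- The boundary of a face is a union of whole arcs, so a closed cell meeting the interior of an
edge contains all of it. -/
theorem range_arc_subset_cell (hε : ε.IsEvenFace) {e : G.edgeSet} {t : unitInterval} (h0 : t ≠ 0)
    (h1 : t ≠ 1) (k : V ⊕ G.edgeSet ⊕ ε.Face) (hk : ε.arc e t ∈ ε.cell k) :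
    range (ε.arc e) ⊆ ε.cell k := by
  rcases k with v | e' | F
  · exact absurd hk (ε.arc_avoids_vtx e t h0 h1 v)
  · rw [ε.eq_of_arc_mem_range h0 h1 hk]; exact Subset.rfl
  · obtain ⟨v, C, -, -, hb⟩ := hε F
    have := (Face.mem_closure_iff hb (ε.range_arc_subset_carrier e ⟨t, rfl⟩)).1 hk
    obtain ⟨e', he', ht⟩ := mem_iUnion₂.1 this
    rw [ε.eq_of_arc_mem_range h0 h1 ht] at he'
    exact (Face.onBoundary_iff_mem_edges hb).2 he'

theorem cellVerts_arc (hε : ε.IsEvenFace) {e : G.edgeSet} {t : unitInterval} (h0 : t ≠ 0)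
    (h1 : t ≠ 1) : ε.cellVerts (ε.arc e t) = {v | v ∈ (e : Sym2 V)} := by
  apply Subset.antisymm
  · intro v hv
    obtain ⟨s, hs⟩ := hv (.inr (.inl e)) ⟨t, rfl⟩
    exact ε.mem_of_arc_eq_vtx hs
  · exact fun v hv k hk => range_arc_subset_cell hε h0 h1 k hk (ε.vtx_mem_range_arc hv)

theorem cellEdges_arc (hε : ε.IsEvenFace) {e : G.edgeSet} {t : unitInterval} (h0 : t ≠ 0)
    (h1 : t ≠ 1) : ε.cellEdges (ε.arc e t) = {e} := by
  apply Subset.antisymm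
  · intro e' he'
    exact ε.range_arc_subset_iff.1 (he' (.inr (.inl e)) ⟨t, rfl⟩)
  · rintro _ rfl k hk
    exact range_arc_subset_cell hε h0 h1 k hk

theorem closure_subset_cell {F : ε.Face} (hε : ε.IsEvenFace) {r : ProjectivePlane} (hr : r ∈ F.1)
    (k : V ⊕ G.edgeSet ⊕ ε.Face) (hk : r ∈ ε.cell k) : closure F.1 ⊆ ε.cell k := by
  have hr' : r ∉ ε.carrier := F.subset_compl_carrier hr
  rcases k with v | e | F'
  · exact absurd (Or.inl ⟨v, (Eq.symm hk : _)⟩) hr'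
  · exact absurd (ε.range_arc_subset_carrier e hk) hr'
  · obtain ⟨v, C, -, -, hb⟩ := hε F'
    have hk' : r ∈ closure F'.1 := hk
    rw [Face.closure_eq hb] at hk'
    rw [Face.eq_of_mem hr (hk'.resolve_right fun h => hr' (ε.trace_subset_carrier C h))]
    exact Subset.rfl

theorem cellEdges_face (hε : ε.IsEvenFace) {F : ε.Face} {v : V} {C : G.Walk v v}
    (hb : ε.IsDiskBoundedBy F.1 C) {r : ProjectivePlane} (hr : r ∈ F.1) :
    ε.cellEdges r = {e : G.edgeSet | (e : Sym2 V) ∈ C.edges} := by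
  ext e
  rw [mem_ofPred_eq, ← Face.onBoundary_iff_mem_edges hb]
  exact ⟨fun h => h (.inr (.inr F)) (subset_closure hr),
    fun h k hk => Subset.trans h (closure_subset_cell hε hr k hk)⟩

theorem cellVerts_face (hε : ε.IsEvenFace) {F : ε.Face} {v : V} {C : G.Walk v v} (hC : C.IsCycle)
    (hb : ε.IsDiskBoundedBy F.1 C) {r : ProjectivePlane} (hr : r ∈ F.1) :
    ε.cellVerts r = {u | u ∈ C.support} := by
  ext u
  constructor
  · intro h
    have h1 : ε.vtx u ∈ closure F.1 := h (.inr (.inr F)) (subset_closure hr)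
    rw [Face.mem_closure_iff hb (Or.inl ⟨u, rfl⟩)] at h1
    obtain ⟨e, he, t, ht⟩ := mem_iUnion₂.1 h1
    exact SimpleGraph.Walk.mem_support_of_mem_edges he (ε.mem_of_arc_eq_vtx ht)
  · intro h k hk
    obtain ⟨e, he, hu⟩ :=
      (SimpleGraph.Walk.mem_support_iff_exists_mem_edges_of_not_nil hC.not_nil).1 h
    have : (⟨e, C.edges_subset_edgeSet he⟩ : G.edgeSet) ∈ ε.cellEdges r := by
      rw [cellEdges_face hε hb hr]; exact he
    exact this k hk (ε.vtx_mem_range_arc hu)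

theorem trichotomy (r : ProjectivePlane) : (∃ v, r = ε.vtx v) ∨
    (∃ e t, t ≠ 0 ∧ t ≠ 1 ∧ r = ε.arc e t) ∨ ∃ F : ε.Face, r ∈ F.1 := by
  by_cases hr : r ∈ ε.carrier
  · rcases hr with ⟨v, hv⟩ | hr
    · exact Or.inl ⟨v, hv.symm⟩
    · obtain ⟨e, t, rfl⟩ := mem_iUnion.1 hr
      by_cases h0 : t = 0
      · obtain ⟨v, -, hv⟩ := ε.exists_vtx_eq_arc_zero e
        exact Or.inl ⟨v, h0 ▸ hv⟩
      · by_cases h1 : t = 1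
        · obtain ⟨v, -, hv⟩ := ε.exists_vtx_eq_arc_one e
          exact Or.inl ⟨v, h1 ▸ hv⟩
        · exact Or.inr (Or.inl ⟨e, t, h0, h1, rfl⟩)
  · exact Or.inr (Or.inr ⟨⟨_, r, hr, rfl⟩, mem_connectedComponentIn hr⟩)

/-- An embedded finite graph with an orientation of the dual graph and with all faces bounded by
cycles has finitely many faces. -/
theorem finite_face [Finite G.edgeSet] (hε : ε.IsEvenFace) (D : ε.DualOrientation) :
    Finite ε.Face := by
  -- Each face has an edge on its bounding cycle, so it is the tail or head of that dual arc.
  have : (range D.tail ∪ range D.head) = univ := by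
    refine eq_univ_of_forall fun F => ?_
    obtain ⟨v, C, hC, -, hb⟩ := hε F
    obtain ⟨e, he⟩ := List.exists_mem_of_ne_nil C.edges
      (mt SimpleGraph.Walk.edges_eq_nil.1 hC.not_nil)
    rcases (D.onBoundary_iff ⟨e, C.edges_subset_edgeSet he⟩ F).1
      ((Face.onBoundary_iff_mem_edges hb).2 he) with h | h
    · exact Or.inl ⟨_, h.symm⟩
    · exact Or.inr ⟨_, h.symm⟩
  rw [← finite_univ_iff, ← this]
  exact (finite_range _).union (finite_range _)

end Embedding

end

/-! ### Edge sums along cycles, and circulations as vanishing alternating sums. -/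

section

variable {V : Type*} {G : SimpleGraph V}

/-- The sum of the values at the two ends of an edge. -/
def endSum {R : Type*} [AddCommMonoid R] (x : V → R) (e : Sym2 V) : R :=
  Sym2.lift ⟨fun u v => x u + x v, fun _ _ => add_comm _ _⟩ e

@[simp]
theorem endSum_mk {R : Type*} [AddCommMonoid R] (x : V → R) (u v : V) :
    endSum x s(u, v) = x u + x v := rfl

theorem endSum_congr {R : Type*} [AddCommMonoid R] {x y : V → R} {e : Sym2 V}
    (h : ∀ u ∈ e, x u = y u) : endSum x e = endSum y e := by
  induction e with | _ u v
  rw [endSum_mk, endSum_mk, h u (Sym2.mem_mk_left _ _), h v (Sym2.mem_mk_right _ _)]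

theorem endSum_add {R : Type*} [AddCommMonoid R] (x y : V → R) (e : Sym2 V) :
    endSum (x + y) e = endSum x e + endSum y e := by
  induction e with | _ u v
  simp only [endSum_mk, Pi.add_apply]
  abel

theorem incidence_mulVec [Fintype V] (x : V → ℝ) (e : G.edgeSet) :
    (incidence G).mulVec x e = endSum x e := by
  classical
  obtain ⟨e, he⟩ := e
  induction e with | _ u v
  have huv : u ≠ v := G.ne_of_adj he
  simp only [Matrix.mulVec, dotProduct, incidence, Matrix.of_apply, endSum_mk, Sym2.mem_iff,
    ite_mul, one_mul, zero_mul]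
  rw [← Finset.sum_filter, show Finset.univ.filter (fun k => k = u ∨ k = v) = {u, v} by
    ext; simp, Finset.sum_pair huv]

theorem endSum_intCast (x : V → ℤ) (e : Sym2 V) :
    endSum (fun v => (x v : ℝ)) e = (endSum x e : ℤ) := by
  induction e with | _ u v
  simp

section Walk

/-- The `i`-th edge of a walk. -/
def edgeAt {u v : V} (p : G.Walk u v) (i : ℕ) (hi : i < p.length) : G.edgeSet :=
  ⟨s(p.getVert i, p.getVert (i + 1)), p.adj_getVert_succ hi⟩

theorem edgeAt_mem {u v : V} (p : G.Walk u v) {i : ℕ} (hi : i < p.length) :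
    (edgeAt p i hi : Sym2 V) ∈ p.edges := by
  have : (edgeAt p i hi : Sym2 V) = p.edges[i]'(by simpa using hi) :=
    (SimpleGraph.Walk.getElem_edges ..).symm
  rw [this]
  exact List.getElem_mem _

theorem exists_edgeAt_eq {u v : V} {p : G.Walk u v} {e : G.edgeSet} (he : (e : Sym2 V) ∈ p.edges) :
    ∃ i, ∃ hi : i < p.length, edgeAt p i hi = e := by
  obtain ⟨i, hi, h⟩ := List.mem_iff_getElem.1 he
  refine ⟨i, by simpa using hi, Subtype.ext ?_⟩
  rw [← h, SimpleGraph.Walk.getElem_edges]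
  rfl

theorem edgeAt_injective {u v : V} {p : G.Walk u v} (hp : p.IsTrail) {i j : ℕ} {hi : i < p.length}
    {hj : j < p.length} (h : edgeAt p i hi = edgeAt p j hj) : i = j := by
  have h' := congrArg Subtype.val h
  refine (hp.edges_nodup.getElem_inj_iff (hi := by simpa using hi) (hj := by simpa using hj)).1 ?_
  rw [SimpleGraph.Walk.getElem_edges, SimpleGraph.Walk.getElem_edges]
  exact h'

/-- A function on the edges, read along a walk. -/
def along {R : Type*} [Zero R] {u v : V} (p : G.Walk u v) (f : G.edgeSet → R) (i : ℕ) : R :=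
  if hi : i < p.length then f (edgeAt p i hi) else 0

theorem along_of_lt {R : Type*} [Zero R] {u v : V} {p : G.Walk u v} {f : G.edgeSet → R} {i : ℕ}
    (hi : i < p.length) : along p f i = f (edgeAt p i hi) := dif_pos hi

theorem sum_edges_eq_sum_along [Fintype G.edgeSet] {R : Type*} [AddCommMonoid R] {u v : V}
    {p : G.Walk u v} (hp : p.IsTrail) (f : G.edgeSet → R)
    [DecidablePred fun e : G.edgeSet => (e : Sym2 V) ∈ p.edges] :
    ∑ e ∈ Finset.univ.filter (fun e : G.edgeSet => (e : Sym2 V) ∈ p.edges), f e =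
      ∑ i ∈ Finset.range p.length, along p f i := by
  symm
  refine Finset.sum_bij (fun i hi => edgeAt p i (Finset.mem_range.1 hi)) ?_ ?_ ?_ ?_
  · intro i hi
    simpa using edgeAt_mem p _
  · intro i hi j hj h
    exact edgeAt_injective hp h
  · intro e he
    obtain ⟨i, hi, h⟩ := exists_edgeAt_eq (Finset.mem_filter.1 he).2
    exact ⟨i, Finset.mem_range.2 hi, h⟩
  · intro i hi
    exact along_of_lt _

theorem sum_alternating_telescope (a : ℕ → ℤ) (n : ℕ) :
    ∑ i ∈ Finset.range n, (-1) ^ i * (a i + a (i + 1)) = a 0 - (-1) ^ n * a n := by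
  induction n with
  | zero => simp
  | succ n ih => rw [Finset.sum_range_succ, ih]; ring

theorem along_endSum {u v : V} {p : G.Walk u v} {x : V → ℤ} {i : ℕ} (hi : i < p.length) :
    along p (fun e => endSum x e) i = x (p.getVert i) + x (p.getVert (i + 1)) := by
  rw [along_of_lt hi]; rfl

theorem sum_alternating_endSum {v : V} {p : G.Walk v v} (hp : Even p.length) (x : V → ℤ) :
    ∑ i ∈ Finset.range p.length, (-1) ^ i * along p (fun e => endSum x e) i = 0 := by
  rw [Finset.sum_congr rfl fun i hi => by rw [along_endSum (Finset.mem_range.1 hi)],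
    sum_alternating_telescope (fun i => x (p.getVert i)), hp.neg_one_pow]
  simp

theorem sum_along_endSum {v : V} {p : G.Walk v v} (x : V → ℤ) :
    ∑ i ∈ Finset.range p.length, along p (fun e => endSum x e) i =
      2 * ∑ i ∈ Finset.range p.length, x (p.getVert i) := by
  rw [Finset.sum_congr rfl fun i hi => along_endSum (Finset.mem_range.1 hi),
    Finset.sum_add_distrib]
  -- Splitting off the last or the first term compares the sum with its shift; the split terms
  -- coincide because the walk is closed.
  have h := Finset.sum_range_succ (fun i => x (p.getVert i)) p.length
  rw [Finset.sum_range_succ'] at h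
  simp only [SimpleGraph.Walk.getVert_zero, SimpleGraph.Walk.getVert_length] at h
  linarith

/-- An even cycle with vanishing alternating sum admits a labelling with prescribed edge sums and
a prescribed value at its start. -/
theorem exists_labelling_of_isCycle {v : V} {p : G.Walk v v} (hp : p.IsCycle)
    (heven : Even p.length) {w : G.edgeSet → ℤ}
    (hw : ∑ i ∈ Finset.range p.length, (-1) ^ i * along p w i = 0) (k : ℤ) :
    ∃ X : V → ℤ, X v = k ∧ ∀ e : G.edgeSet, (e : Sym2 V) ∈ p.edges → endSum X e = w e := by
  classical
  -- The start value forces all later ones. The vanishing alternating sum is exactly what makes the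
  -- recursion close up after an even number of steps.
  let a : ℕ → ℤ := fun i => Nat.rec k (fun i b => along p w i - b) i
  have ha : ∀ i, a i + a (i + 1) = along p w i := fun i => by
    change a i + (along p w i - a i) = _; ring
  have hn : a p.length = a 0 := by
    have := sum_alternating_telescope a p.length
    simp only [ha] at this
    rw [hw, heven.neg_one_pow] at this
    linarith
  have hpos : 0 < p.length := hp.three_le_length.trans_lt' (by norm_num)
  -- A cycle visits each of its vertices at just one index below its length, so the choice is
  -- harmless; the value `0` off the cycle plays no role.
  let X : V → ℤ := fun u => if h : ∃ i < p.length, p.getVert i = u then a h.choose else 0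
  have hX : ∀ i < p.length, X (p.getVert i) = a i := fun i hi => by
    have h : ∃ j < p.length, p.getVert j = p.getVert i := ⟨i, hi, rfl⟩
    have h1 : X (p.getVert i) = a h.choose := dif_pos h
    have h2 := h.choose_spec
    rw [h1, hp.getVert_injOn' (Nat.le_sub_one_of_lt h2.1) (Nat.le_sub_one_of_lt hi) h2.2]
  have hXv : X v = k := by
    have := hX 0 hpos
    rwa [SimpleGraph.Walk.getVert_zero] at this
  have hX' : ∀ i ≤ p.length, X (p.getVert i) = a i := fun i hi => by
    rcases hi.lt_or_eq with hi | rfl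
    · exact hX i hi
    · rw [SimpleGraph.Walk.getVert_length, hn]; exact hXv
  refine ⟨X, hXv, fun e he => ?_⟩
  obtain ⟨i, hi, rfl⟩ := exists_edgeAt_eq he
  change X _ + X _ = _
  rw [hX' i hi.le, hX' (i + 1) hi, ha, along_of_lt hi]

theorem reflTransGen_of_mem_support {v u : V} {p : G.Walk v v} (hu : u ∈ p.support) :
    Relation.ReflTransGen (fun a b => s(a, b) ∈ p.edges) v u := by
  obtain ⟨i, rfl, hi⟩ := SimpleGraph.Walk.mem_support_iff_exists_getVert.1 hu
  induction i with
  | zero => rw [SimpleGraph.Walk.getVert_zero]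
  | succ i ih =>
    exact (ih (by omega) (SimpleGraph.Walk.getVert_mem_support _ _)).tail
      (edgeAt_mem p (Nat.lt_of_succ_le hi))

end Walk

namespace Embedding.DualOrientation

variable {ε : Embedding G} (D : ε.DualOrientation)

open Classical in
/-- The incidence number of the dual arc of `e` and the dual node `F`. -/
def sgn (F : ε.Face) (e : G.edgeSet) : ℤ :=
  (if D.head e = F then 1 else 0) - if D.tail e = F then 1 else 0

theorem isCirculation_iff [Fintype G.edgeSet] {y : G.edgeSet → ℝ} {z : G.edgeSet → ℤ}
    (hz : ∀ e, y e = z e) : D.IsCirculation y ↔ ∀ F, ∑ e, D.sgn F e * z e = 0 := by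
  classical
  refine forall_congr' fun F => ?_
  rw [← sub_eq_zero, Finset.sum_filter, Finset.sum_filter, ← Finset.sum_sub_distrib,
    ← Int.cast_eq_zero (α := ℝ), Int.cast_sum]
  refine Eq.congr (Finset.sum_congr rfl fun e _ => ?_) rfl
  rw [hz e, sgn]
  split_ifs <;> simp

variable {D}

theorem sgn_eq_zero {F : ε.Face} {e : G.edgeSet} (h : ¬ ε.OnBoundary e F) : D.sgn F e = 0 := by
  rw [D.onBoundary_iff, not_or] at h
  rw [sgn, if_neg (Ne.symm h.2), if_neg (Ne.symm h.1), sub_zero]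

theorem sgn_sq_of_onBoundary {F : ε.Face} {e : G.edgeSet} (h : ε.OnBoundary e F) :
    D.sgn F e * D.sgn F e = 1 := by
  have hne := D.tail_ne_head e
  rcases (D.onBoundary_iff e F).1 h with rfl | rfl
  · simp [sgn, hne.symm]
  · simp [sgn, hne]

theorem sgn_eq_neg (hD : D.IsAlternating) {F : ε.Face} {e e' : G.edgeSet} (h : ε.OnBoundary e F)
    (h' : ε.OnBoundary e' F) (hne : e ≠ e') (hv : ∃ v, v ∈ (e : Sym2 V) ∧ v ∈ (e' : Sym2 V)) :
    D.sgn F e' = -D.sgn F e := by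
  have hh := hD F e e' h h' hne hv
  have h1 := D.tail_ne_head e
  have h2 := D.tail_ne_head e'
  rcases (D.onBoundary_iff e F).1 h with rfl | rfl
  · rcases (D.onBoundary_iff e' (D.tail e)).1 h' with h3 | h3
    · exact absurd (hh.2 h3.symm) h1.symm
    · simp [sgn, h3, h2, h3 ▸ h1.symm]
  · have h3 := hh.1 rfl
    have h4 : D.head e' ≠ D.head e := fun h => h2 (h3.trans h.symm)
    simp [sgn, h3, h1, h4]

/-- Consecutive edges of the boundary cycle share a vertex, so alternation flips the sign at each
step. -/
theorem sgn_edgeAt (hD : D.IsAlternating) {F : ε.Face} {v : V} {C : G.Walk v v} (hC : C.IsCycle)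
    (hb : ε.IsDiskBoundedBy F.1 C) (h0 : 0 < C.length) {i : ℕ} (hi : i < C.length) :
    D.sgn F (edgeAt C i hi) = (-1) ^ i * D.sgn F (edgeAt C 0 h0) := by
  induction i with
  | zero => simp
  | succ i ih =>
    have hi' : i < C.length := (Nat.lt_succ_self i).trans hi
    rw [sgn_eq_neg hD (e := edgeAt C i hi') ((Face.onBoundary_iff_mem_edges hb).2 (edgeAt_mem C hi'))
      ((Face.onBoundary_iff_mem_edges hb).2 (edgeAt_mem C hi)), ih hi', pow_succ]
    · ring
    · intro h
      have := edgeAt_injective hC.isCircuit.isTrail h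
      omega
    · exact ⟨C.getVert (i + 1), Sym2.mem_mk_right _ _, Sym2.mem_mk_left _ _⟩

/-- The net inflow at a face vanishes iff the alternating sum along its boundary cycle does. -/
theorem sum_sgn_eq_zero_iff [Fintype G.edgeSet] (hD : D.IsAlternating) {F : ε.Face} {v : V}
    {C : G.Walk v v} (hC : C.IsCycle) (hb : ε.IsDiskBoundedBy F.1 C) (z : G.edgeSet → ℤ) :
    ∑ e, D.sgn F e * z e = 0 ↔ ∑ i ∈ Finset.range C.length, (-1) ^ i * along C z i = 0 := by
  classical
  have h0 : 0 < C.length := hC.three_le_length.trans_lt' (by norm_num)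
  have hsum : ∑ e, D.sgn F e * z e =
      D.sgn F (edgeAt C 0 h0) * ∑ i ∈ Finset.range C.length, (-1) ^ i * along C z i := by
    rw [← Finset.sum_filter_of_ne (p := fun e : G.edgeSet => (e : Sym2 V) ∈ C.edges),
      sum_edges_eq_sum_along hC.isCircuit.isTrail, Finset.mul_sum]
    · refine Finset.sum_congr rfl fun i hi => ?_
      have hi := Finset.mem_range.1 hi
      rw [along_of_lt hi, along_of_lt hi, sgn_edgeAt hD hC hb h0]
      ring
    · intro e _ he
      by_contra h
      rw [← Face.onBoundary_iff_mem_edges hb] at h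
      exact he (by rw [sgn_eq_zero h, zero_mul])
  have hne : D.sgn F (edgeAt C 0 h0) ≠ 0 := fun h => by
    have := sgn_sq_of_onBoundary (D := D)
      ((Face.onBoundary_iff_mem_edges hb).2 (edgeAt_mem C h0))
    rw [h] at this
    norm_num at this
  rw [hsum, mul_eq_zero, or_iff_right hne]

end Embedding.DualOrientation

end

/-! ### Labellings over the cells, descent from the sphere, and parity. -/

section

variable {V : Type*} {G : SimpleGraph V}

namespace Embedding

variable {ε : Embedding G}

theorem cellVerts_nonempty (hε : ε.IsEvenFace) (r : ProjectivePlane) : (ε.cellVerts r).Nonempty := by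
  rcases trichotomy (ε := ε) r with ⟨v, rfl⟩ | ⟨e, t, h0, h1, rfl⟩ | ⟨F, hr⟩
  · rw [cellVerts_vtx]; exact singleton_nonempty v
  · rw [cellVerts_arc hε h0 h1]
    obtain ⟨v, hv, -⟩ := ε.exists_vtx_eq_arc_zero e
    exact ⟨v, hv⟩
  · obtain ⟨v, C, hC, -, hb⟩ := hε F
    rw [cellVerts_face hε hC hb hr]
    exact ⟨v, C.start_mem_support⟩

/-- The vertices of a closed cell are connected by its edges. -/
theorem cellVerts_connected (hε : ε.IsEvenFace) {r : ProjectivePlane} {u v : V}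
    (hu : u ∈ ε.cellVerts r) (hv : v ∈ ε.cellVerts r) :
    Relation.ReflTransGen (fun a b => ∃ e ∈ ε.cellEdges r, (e : Sym2 V) = s(a, b)) u v := by
  classical
  rcases trichotomy (ε := ε) r with ⟨x, rfl⟩ | ⟨e, t, h0, h1, rfl⟩ | ⟨F, hr⟩
  · rw [cellVerts_vtx] at hu hv
    rw [mem_singleton_iff.1 hu, mem_singleton_iff.1 hv]
  · rw [cellVerts_arc hε h0 h1] at hu hv
    rw [cellEdges_arc hε h0 h1]
    by_cases huv : u = v
    · rw [huv]
    · exact Relation.ReflTransGen.single ⟨e, rfl, (Sym2.mem_and_mem_iff huv).1 ⟨hu, hv⟩⟩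
  · obtain ⟨x, C, hC, -, hb⟩ := hε F
    rw [cellVerts_face hε hC hb hr] at hu hv
    rw [cellEdges_face hε hb hr]
    have hv' : v ∈ (C.rotate u hu).support := (C.mem_support_rotate_iff u hu).2 hv
    refine (reflTransGen_of_mem_support hv').lift id fun a b hab => ?_
    have hab' : s(a, b) ∈ C.edges := (C.rotate_edges u hu).mem_iff.1 hab
    exact ⟨⟨s(a, b), C.edges_subset_edgeSet hab'⟩, hab', rfl⟩

variable [Fintype G.edgeSet]

/-- Over a vertex there is no equation, over an edge the other end gets `w e - k`, and over a face
the boundary cycle, rotated to start at `v`, is labelled recursively. -/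
theorem exists_labelling (hε : ε.IsEvenFace) {D : ε.DualOrientation} (hD : D.IsAlternating)
    {w : G.edgeSet → ℤ} (hw : ∀ F, ∑ e, D.sgn F e * w e = 0) {r : ProjectivePlane} {v : V}
    (hv : v ∈ ε.cellVerts r) (k : ℤ) :
    ∃ X : V → ℤ, (∀ e ∈ ε.cellEdges r, endSum X e = w e) ∧ X v = k := by
  classical
  rcases trichotomy (ε := ε) r with ⟨x, rfl⟩ | ⟨e, t, h0, h1, rfl⟩ | ⟨F, hr⟩
  · refine ⟨fun _ => k, fun e he => ?_, rfl⟩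
    rw [cellEdges_vtx] at he
    exact absurd he (notMem_empty e)
  · rw [cellVerts_arc hε h0 h1] at hv
    rw [cellEdges_arc hε h0 h1]
    refine ⟨fun u => if u = v then k else w e - k, ?_, if_pos rfl⟩
    intro e' he'
    rw [mem_singleton_iff.1 he']
    obtain ⟨u, hu⟩ := hv
    have huv : u ≠ v := by
      have := e.2
      rw [hu] at this
      exact (G.ne_of_adj this).symm
    rw [hu, endSum_mk, if_pos rfl, if_neg huv]
    ring
  · obtain ⟨x, C, hC, heven, hb⟩ := hε F
    rw [cellVerts_face hε hC hb hr] at hv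
    rw [cellEdges_face hε hb hr]
    have hmem : ∀ e, e ∈ (C.rotate v hv).edges ↔ e ∈ C.edges := fun e =>
      (C.rotate_edges v hv).mem_iff
    have hb' : ε.IsDiskBoundedBy F.1 (C.rotate v hv) := by
      have : ε.trace (C.rotate v hv) = ε.trace C := by simp only [trace, hmem]
      simpa only [IsDiskBoundedBy, this] using hb
    have hC' := hC.rotate hv
    obtain ⟨X, hX, hXe⟩ := exists_labelling_of_isCycle hC' (by rwa [C.length_rotate])
      ((DualOrientation.sum_sgn_eq_zero_iff hD hC' hb' w).1 (hw F)) k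
    exact ⟨X, fun e he => hXe e ((hmem e).2 he), hX⟩

/-- The label system of the integer labellings of the vertices with prescribed edge sums. -/
def labelSystem [Finite V] (hε : ε.IsEvenFace) {D : ε.DualOrientation} (hD : D.IsAlternating)
    {w : G.edgeSet → ℤ} (hw : ∀ F, ∑ e, D.sgn F e * w e = 0) : LabelSystem ProjectivePlane V where
  verts := ε.cellVerts
  sol r := {X | ∀ e ∈ ε.cellEdges r, endSum X e = w e}
  nonempty := cellVerts_nonempty hε
  exists_sol _ _ hv k := exists_labelling hε hD hw hv k
  eqOn_of_eq r X hX Y hY v hv hXY u hu := by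
    -- The equation of an edge determines the value at one end from the other; the cell is connected
    -- by its edges.
    have hc := cellVerts_connected hε hv hu
    clear hu
    induction hc with
    | refl => exact hXY
    | tail _ hab ih =>
      obtain ⟨e, he, hab⟩ := hab
      have h1 := hX e he
      have h2 := hY e he
      rw [hab, endSum_mk] at h1 h2
      linarith
  eventually_le r := by
    have := finite_face hε D
    exact (ε.eventually_cell_subset r).mono fun q hq => ⟨hq.1, fun X hX e he => hX e (hq.2 he)⟩

/-- If `w` has vanishing net inflow at every face, then `2 w` is the family of edge sums of an integer
labelling of the vertices with values of constant parity. -/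
theorem exists_double_labelling [Finite V] (hε : ε.IsEvenFace) {D : ε.DualOrientation}
    (hD : D.IsAlternating) {w : G.edgeSet → ℤ} (hw : ∀ F, ∑ e, D.sgn F e * w e = 0) :
    ∃ z : V → ℤ, (∀ e : G.edgeSet, endSum z e = 2 * w e) ∧ ∀ u v, Even (z u) ↔ Even (z v) := by
  obtain ⟨s, hs⟩ := ((labelSystem hε hD hw).comap (Quotient.mk antipodal)
    continuous_quotient_mk').exists_isSection_sphere
  have hmk : ∀ p, Quotient.mk antipodal (-p) = Quotient.mk antipodal p := fun p =>
    (Quotient.sound (Or.inr rfl))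
  -- Antipodal values of `s` solve the same equations but may differ because of monodromy. Their sum
  -- is symmetric, so it descends, at the price of doubling `w`.
  let Z : ProjectivePlane → V → ℤ := Quotient.lift (fun p => s p + s (-p)) (by
    rintro p q (h | h)
    · rw [h]
    · rw [h, neg_neg, add_comm])
  have hZs : ∀ p, Z (Quotient.mk antipodal p) = s p + s (-p) := fun _ => rfl
  have hZsol : ∀ r, ∀ e ∈ ε.cellEdges r, endSum (Z r) e = 2 * w e := by
    intro r e he
    induction r using Quotient.inductionOn with | _ p
    have h1 : endSum (s p) e = w e := hs.mem_sol p e he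
    have h2 : endSum (s (-p)) e = w e := hs.mem_sol (-p) e (by
      rw [hmk]; exact he)
    rw [hZs, endSum_add, h1, h2, two_mul]
  have hZloc : ∀ r, ∀ᶠ q in 𝓝 r, EqOn (Z q) (Z r) (ε.cellVerts r) := by
    intro r
    induction r using Quotient.inductionOn with | _ p
    have h1 := hs.eventually_eqOn p
    have h2 := (continuous_neg.tendsto p).eventually (hs.eventually_eqOn (-p))
    have h3 : ∀ᶠ c in 𝓝 p, EqOn (Z (Quotient.mk antipodal c)) (Z (Quotient.mk antipodal p))
        (ε.cellVerts (Quotient.mk antipodal p)) := by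
      filter_upwards [h1, h2] with c hc1 hc2 u hu
      rw [hZs, hZs, Pi.add_apply, Pi.add_apply, hc1 hu]
      congr 1
      refine hc2 ?_
      change u ∈ ε.cellVerts (Quotient.mk antipodal (-p))
      rwa [hmk]
    refine mem_of_superset (isOpenMap_antipodal_mk.image_mem_nhds h3) ?_
    rintro _ ⟨c, hc, rfl⟩
    exact hc
  have hpar : ∀ r, ∀ u ∈ ε.cellVerts r, ∀ v ∈ ε.cellVerts r, (Even (Z r u) ↔ Even (Z r v)) := by
    intro r u hu v hv
    have hc := cellVerts_connected hε hu hv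
    clear hv
    induction hc with
    | refl => rfl
    | tail _ hab ih =>
      obtain ⟨e, he, hab⟩ := hab
      have h := hZsol r e he
      rw [hab, endSum_mk] at h
      exact ih.trans (Int.even_add.1 (h ▸ even_two_mul _))
  have hfin := finite_face hε D
  have hpre : IsPreconnected (univ : Set ProjectivePlane) := by
    have : IsPreconnected (Metric.sphere (0 : EuclideanSpace ℝ (Fin 3)) 1) :=
      isPreconnected_sphere (by rw [← Module.finrank_eq_rank]; simp) _ _
    have := isPreconnected_iff_preconnectedSpace.1 this
    have h2 := isPreconnected_range (continuous_quotient_mk' (s := antipodal))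
    rwa [(@Quotient.mk'_surjective _ antipodal).range_eq] at h2
  have hparity : ∀ r q, ∀ u ∈ ε.cellVerts r, ∀ v ∈ ε.cellVerts q,
      (Even (Z r u) ↔ Even (Z q v)) := by
    intro r q
    refine hpre.induction₂ (fun r q => ∀ u ∈ ε.cellVerts r, ∀ v ∈ ε.cellVerts q,
      (Even (Z r u) ↔ Even (Z q v))) ?_ ?_ ?_ (mem_univ r) (mem_univ q)
    · intro r _
      rw [nhdsWithin_univ]
      filter_upwards [hZloc r, ε.eventually_cell_subset r] with q h1 h2 u hu v hv
      rw [← h1 hu]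
      exact hpar q u (h2.1 hu) v hv
    · intro x y z _ _ _ h1 h2 u hu v hv
      obtain ⟨a, ha⟩ := cellVerts_nonempty hε y
      exact (h1 u hu a ha).trans (h2 a ha v hv)
    · exact fun x y _ _ h u hu v hv => (h v hv u hu).symm
  have hself : ∀ v, v ∈ ε.cellVerts (ε.vtx v) := fun v => by rw [cellVerts_vtx]; rfl
  -- Along a curve over which `u` stays relevant, the value at `u` is locally constant, hence
  -- constant.
  have hconst : ∀ {u : V} {γ : ℝ → ProjectivePlane} {I : Set ℝ}, IsPreconnected I → Continuous γ →
      (∀ x ∈ I, u ∈ ε.cellVerts (γ x)) → ∀ x ∈ I, ∀ y ∈ I, Z (γ x) u = Z (γ y) u := by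
    intro u γ I hI hγ hu x hx y hy
    refine hI.induction₂ (fun x y => Z (γ x) u = Z (γ y) u) ?_ (fun _ _ _ _ _ _ => Eq.trans)
      (fun _ _ _ _ => Eq.symm) hx hy
    intro x hx
    refine nhdsWithin_le_nhds ?_
    filter_upwards [hγ.continuousAt.eventually (hZloc (γ x))] with y hy
    exact (hy (hu x hx)).symm
  -- Each vertex is read over its own point. Both ends of an edge are then carried along the arc to
  -- its midpoint, where the edge equation is available.
  refine ⟨fun v => Z (ε.vtx v) v, fun e => ?_, fun u v => hparity _ _ u (hself u) v (hself v)⟩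
  let γ : ℝ → ProjectivePlane := fun x => ε.arc e (projIcc 0 1 zero_le_one x)
  have hγ : Continuous γ := (ε.arc_continuous e).comp continuous_projIcc
  have hγ0 : γ 0 = ε.arc e 0 := by simp [γ, projIcc_left]
  have hγ1 : γ 1 = ε.arc e 1 := by simp [γ, projIcc_right]
  have hγi : ∀ x, 0 < x → x < 1 → ∃ t : unitInterval, t ≠ 0 ∧ t ≠ 1 ∧ γ x = ε.arc e t := by
    intro x h0 h1
    refine ⟨⟨x, h0.le, h1.le⟩, fun h => h0.ne' (congrArg Subtype.val h),
      fun h => h1.ne (congrArg Subtype.val h), ?_⟩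
    simp only [γ, projIcc_of_mem zero_le_one (show x ∈ Icc (0 : ℝ) 1 from ⟨h0.le, h1.le⟩)]
  have hverts : ∀ x, 0 < x → x < 1 → ∀ u ∈ (e : Sym2 V), u ∈ ε.cellVerts (γ x) := by
    intro x h0 h1 u hu
    obtain ⟨t, ht0, ht1, ht⟩ := hγi x h0 h1
    rw [ht, cellVerts_arc hε ht0 ht1]
    exact hu
  have hmid : ∀ u ∈ (e : Sym2 V), Z (ε.vtx u) u = Z (γ (1 / 2)) u := by
    intro u hu
    rcases ε.exists_arc_eq_vtx hu with h | h
    · rw [← h, ← hγ0]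
      refine hconst (isPreconnected_Icc (a := 0) (b := 1 / 2)) hγ ?_ _ (by norm_num) _ (by norm_num)
      intro x hx
      rcases hx.1.eq_or_lt with h0 | h0
      · rw [← h0, hγ0, h]; exact hself u
      · exact hverts x h0 (by linarith [hx.2]) u hu
    · rw [← h, ← hγ1]
      refine hconst (isPreconnected_Icc (a := 1 / 2) (b := 1)) hγ ?_ _ (by norm_num) _ (by norm_num)
      intro x hx
      rcases hx.2.eq_or_lt with h0 | h0
      · rw [h0, hγ1, h]; exact hself u
      · exact hverts x (by linarith [hx.1]) h0 u hu
  rw [endSum_congr hmid]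
  obtain ⟨t, ht0, ht1, ht⟩ := hγi (1 / 2) (by norm_num) (by norm_num)
  refine hZsol _ e ?_
  rw [ht, cellEdges_arc hε ht0 ht1]
  rfl

/-- A family of integers on the edges with vanishing net inflow at every face and even sum over an odd
cycle is the family of edge sums of an integer labelling of the vertices. -/
theorem exists_labelling_of_even_sum [Finite V] (hε : ε.IsEvenFace) {D : ε.DualOrientation}
    (hD : D.IsAlternating) {w : G.edgeSet → ℤ} (hw : ∀ F, ∑ e, D.sgn F e * w e = 0) {u : V}
    {C : G.Walk u u} (hodd : Odd C.length)
    (heven : Even (∑ i ∈ Finset.range C.length, along C w i)) :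
    ∃ x : V → ℤ, ∀ e : G.edgeSet, endSum x e = w e := by
  obtain ⟨z, hz, hpar⟩ := exists_double_labelling hε hD hw
  have hsum : ∑ i ∈ Finset.range C.length, z (C.getVert i) =
      ∑ i ∈ Finset.range C.length, along C w i := by
    have h := sum_along_endSum (p := C) z
    have h2 : ∑ i ∈ Finset.range C.length, along C (fun e => endSum z e) i =
        2 * ∑ i ∈ Finset.range C.length, along C w i := by
      rw [Finset.mul_sum]
      refine Finset.sum_congr rfl fun i hi => ?_
      have hi := Finset.mem_range.1 hi
      rw [along_of_lt hi, along_of_lt hi, hz]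
    linarith
  -- Otherwise all values are odd, and an odd number of them along `C` has odd sum.
  have hz_even : ∀ v, Even (z v) := by
    by_contra! h
    obtain ⟨v, hv⟩ := h
    have hall : ∀ v, Odd (z v) := fun x => Int.not_even_iff_odd.1 fun hx => hv ((hpar x v).1 hx)
    choose y hy using hall
    rw [← hsum, Finset.sum_congr rfl fun i _ => hy _, Finset.sum_add_distrib, ← Finset.mul_sum,
      Finset.sum_const, Finset.card_range, nsmul_one] at heven
    exact Int.not_even_iff_odd.2 ((even_two_mul _).add_odd ((Int.odd_coe_nat _).2 hodd)) heven
  choose x hx using fun v => (hz_even v).two_dvd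
  refine ⟨x, fun e => ?_⟩
  have : endSum z e = 2 * endSum x e := by
    obtain ⟨e, he⟩ := e
    induction e with | _ a b
    simp only [endSum_mk, hx]
    ring
  have h2 := hz e
  linarith

end Embedding

/-! ### Integer points and passage to convex hulls. -/

/-- The images under `σ` of the integer points of `P(G)` are the nonnegative integer circulations with
odd sum over a given odd cycle. -/
theorem image_sigma_eq {V : Type*} [Fintype V] [DecidableEq V] (G : SimpleGraph V)
    [DecidableRel G.Adj] (ε : OddCirc.Embedding G) (hε : ε.IsEvenFace)
    (D : ε.DualOrientation) (hD : D.IsAlternating)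
    {u : V} (C : G.Walk u u) (hC : C.IsCycle) (hodd : Odd C.length) :
    sigma G '' {x | (∃ z : V → ℤ, ∀ v, x v = z v) ∧ (incidence G).mulVec x ≤ 1} =
      {y : G.edgeSet → ℝ |
        ∃ z : G.edgeSet → ℤ, (∀ e, y e = z e) ∧ (∀ e, 0 ≤ z e) ∧ D.IsCirculation y ∧
          Odd (∑ e ∈ Finset.univ.filter (fun e : G.edgeSet => (e : Sym2 V) ∈ C.edges), z e)} := by
  have halong : ∀ {v : V} {p : G.Walk v v} (f : G.edgeSet → ℤ) {i : ℕ}, i ∈ Finset.range p.length →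
      along p (fun e => 1 - f e) i = 1 - along p f i := by
    intro v p f i hi
    rw [along_of_lt (Finset.mem_range.1 hi), along_of_lt (Finset.mem_range.1 hi)]
  -- The all-ones vector is a circulation because face cycles are even, so `f` and `1 - f` are
  -- circulations together.
  have hface : ∀ (f : G.edgeSet → ℤ) (F : ε.Face), ∑ e, D.sgn F e * f e = 0 →
      ∑ e, D.sgn F e * (1 - f e) = 0 := by
    intro f F hf
    obtain ⟨v, p, hp, heven, hb⟩ := hε F
    rw [Embedding.DualOrientation.sum_sgn_eq_zero_iff hD hp hb] at hf ⊢
    rw [Finset.sum_congr rfl fun i hi => by rw [halong f hi, mul_sub, mul_one],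
      Finset.sum_sub_distrib, hf, neg_one_geom_sum, if_pos heven, sub_zero]
  have hsum : ∀ f : G.edgeSet → ℤ,
      ∑ e ∈ Finset.univ.filter (fun e : G.edgeSet => (e : Sym2 V) ∈ C.edges), (1 - f e) =
        C.length - ∑ i ∈ Finset.range C.length, along C f i := by
    intro f
    rw [sum_edges_eq_sum_along hC.isCircuit.isTrail, Finset.sum_congr rfl fun i hi => halong f hi,
      Finset.sum_sub_distrib]
    simp
  have hsig : ∀ (x : V → ℤ) (e : G.edgeSet),
      sigma G (fun v => (x v : ℝ)) e = ((1 - endSum x e : ℤ) : ℝ) := by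
    intro x e
    rw [sigma, Pi.sub_apply, incidence_mulVec, endSum_intCast]
    simp
  ext y
  constructor
  · rintro ⟨x, ⟨⟨z, hz⟩, hx⟩, rfl⟩
    obtain rfl : x = fun v => (z v : ℝ) := funext hz
    refine ⟨fun e => 1 - endSum z e, hsig z, fun e => ?_, ?_, ?_⟩
    · have := hx e
      rw [incidence_mulVec, endSum_intCast, Pi.one_apply] at this
      exact sub_nonneg.2 (Int.cast_le.1 (this.trans_eq Int.cast_one.symm))
    · rw [D.isCirculation_iff (hsig z)]
      refine fun F => hface _ F ?_
      obtain ⟨v, p, hp, heven, hb⟩ := hε F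
      rw [Embedding.DualOrientation.sum_sgn_eq_zero_iff hD hp hb]
      exact sum_alternating_endSum heven z
    · rw [hsum, sum_along_endSum]
      exact ((Int.odd_coe_nat _).2 hodd).sub_even (even_two_mul _)
  · rintro ⟨z, hyz, hpos, hcirc, hz⟩
    rw [D.isCirculation_iff hyz] at hcirc
    have hz' := hsum fun e => 1 - z e
    simp only [sub_sub_cancel] at hz'
    rw [hz'] at hz
    obtain ⟨x, hx⟩ := Embedding.exists_labelling_of_even_sum hε hD
      (w := fun e => 1 - z e) (fun F => hface z F (hcirc F)) hodd (by
        by_contra h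
        rw [Int.not_even_iff_odd] at h
        exact Int.not_odd_iff_even.2 (((Int.odd_coe_nat _).2 hodd).sub_odd h) hz)
    have hsx : sigma G (fun v => (x v : ℝ)) = y := by
      funext e
      rw [hsig, hx, hyz, sub_sub_cancel]
    refine ⟨fun v => x v, ⟨⟨x, fun v => rfl⟩, fun e => ?_⟩, hsx⟩
    have h1 := congrFun hsx e
    rw [sigma, Pi.sub_apply, hyz, Pi.one_apply] at h1
    have h2 : (0 : ℝ) ≤ z e := by exact_mod_cast hpos e
    rw [Pi.one_apply]
    linarith

end

end OddCirc

end

/-- Affine maps commute with convex hulls, so the equality of the generating sets suffices. -/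
theorem lemma3 {V : Type*} [Fintype V] [DecidableEq V] (G : SimpleGraph V) [DecidableRel G.Adj]
    (hG : ¬ G.IsBipartite)
    (ε : OddCirc.Embedding G) (hε : ε.IsEvenFace)
    (D : ε.DualOrientation) (hD : D.IsAlternating)
    {u : V} (C : G.Walk u u) (hC : C.IsCycle) (hodd : Odd C.length) :
    OddCirc.Q G =
      convexHull ℝ {y : G.edgeSet → ℝ |
        ∃ z : G.edgeSet → ℤ, (∀ e, y e = z e) ∧ (∀ e, 0 ≤ z e) ∧ D.IsCirculation y ∧
          Odd (∑ e ∈ Finset.univ.filter (fun e : G.edgeSet => (e : Sym2 V) ∈ C.edges), z e)} := by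
  rw [← OddCirc.image_sigma_eq G ε hε D hD C hC hodd]
  let A : (V → ℝ) →ᵃ[ℝ] (G.edgeSet → ℝ) :=
    AffineMap.const ℝ _ 1 - (OddCirc.incidence G).mulVecLin.toAffineMap
  have hA : ⇑A = OddCirc.sigma G := by
    funext x
    rfl
  rw [OddCirc.Q, OddCirc.P, ← hA, AffineMap.image_convexHull]
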